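/- Let $(\tilde M,\varphi,\xi,\eta,g)$ be a Sasakian manifold, i.e. a smooth manifold with an almost contact metric structure ($\varphi^2=-I+\eta\otimes\xi$, $\eta(\xi)=1$, $\varphi\xi=0$, $\eta\circ\varphi=0$, $g(\varphi X,\varphi Y)=g(X,Y)-\eta(X)\eta(Y)$) such that $(\tilde\nabla_X\varphi)Y=g(X,Y)\xi-\eta(Y)X$ for all vector fields $X,Y$, where $\tilde\nabla$ is the Levi-Civita connection of $g$. Let $M_T$ and $M_\theta$ be Riemannian manifolds of positive dimension with metrics $g_T$, $g_\theta$. A *warped product pointwise semi-slant submanifold* $M=M_T\times_f M_\theta$ of $\tilde M$ (tangent to $\xi$) is given by a smooth function $f>0$ on $M_T$ and a smooth isometric immersion into $\tilde M$ of $M_T\times M_\theta$ with the warped product metric $\pi_1^*g_T+(f\circ\pi_1)^2\pi_2^*g_\theta$, such that $\xi$ is tangent to $M$, every copy $M_T\times\{b\}$ is an invariant submanifold ($\varphi$ maps its tangent spaces into themselves), and every copy $\{a\}\times M_\theta$ is a pointwise slant submanifold: there is a function $\theta$ on $M$ (the slant function) such that, for each point $p=(a,b)$ and each nonzero vector $Z$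 tangent to $\{a\}\times M_\theta$ at $p$ and not proportional to $\xi_p$, the angle between $\varphi Z$ and the tangent space of $\{a\}\times M_\theta$ at $p$ equals $\theta(p)$. It is *proper* if $\theta$ is neither identically $0$, nor identically $\pi/2$, nor constant on $M$. It is *mixed totally geodesic* if its second fundamental form $h$ in $\tilde M$ satisfies $h(X,Z)=0$ for all vector fields $X$ tangent to $M_T$ and $Z$ tangent to $M_\theta$. Then there is no mixed totally geodesic proper warped product pointwise semi-slant submanifold $M=M_T\times_f M_\theta$ of a Sasakian manifold $\tilde M$. -/

import Mathlib

open Bundle Manifold Topology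
open scoped ContDiff

/-! ### Sasakian manifolds -/

section Sasakian

variable (E : Type*) [NormedAddCommGroup E] [NormedSpace ℝ E] [FiniteDimensional ℝ E]
  (N : Type*) [TopologicalSpace N] [ChartedSpace E N] [IsManifold 𝓘(ℝ, E) ∞ N]
  [RiemannianBundle (fun x : N ↦ TangentSpace 𝓘(ℝ, E) x)]
  [IsContMDiffRiemannianBundle 𝓘(ℝ, E) ∞ E (fun x : N ↦ TangentSpace 𝓘(ℝ, E) x)]

/-- An almost contact metric structure `(φ, ξ, η, g)` on the smooth manifold `N`, where `g` is
the given Riemannian metric of `N`. -/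
structure AlmostContactMetricStructure where
  /-- The `(1, 1)` tensor field. -/
  φ : Π x : N, TangentSpace 𝓘(ℝ, E) x →L[ℝ] TangentSpace 𝓘(ℝ, E) x
  /-- The Reeb vector field. -/
  ξ : Π x : N, TangentSpace 𝓘(ℝ, E) x
  /-- The contact form. -/
  η : Π x : N, TangentSpace 𝓘(ℝ, E) x →L[ℝ] ℝ
  smooth_φ : ContMDiff 𝓘(ℝ, E) (𝓘(ℝ, E).prod 𝓘(ℝ, E →L[ℝ] E)) ∞
    (fun x ↦ TotalSpace.mk' (E →L[ℝ] E)
      (E := fun x : N ↦ TangentSpace 𝓘(ℝ, E) x →L[ℝ] TangentSpace 𝓘(ℝ, E) x) x (φ x))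
  smooth_ξ : ContMDiff 𝓘(ℝ, E) (𝓘(ℝ, E).prod 𝓘(ℝ, E)) ∞
    (fun x ↦ TotalSpace.mk' E (E := fun x : N ↦ TangentSpace 𝓘(ℝ, E) x) x (ξ x))
  smooth_η : ContMDiff 𝓘(ℝ, E) (𝓘(ℝ, E).prod 𝓘(ℝ, E →L[ℝ] ℝ)) ∞
    (fun x ↦ TotalSpace.mk' (E →L[ℝ] ℝ)
      (E := fun x : N ↦ TangentSpace 𝓘(ℝ, E) x →L[ℝ] ℝ) x (η x))
  φ_φ : ∀ (x : N) (v : TangentSpace 𝓘(ℝ, E) x), φ x (φ x v) = -v + η x v • ξ x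
  η_ξ : ∀ x : N, η x (ξ x) = 1
  φ_ξ : ∀ x : N, φ x (ξ x) = 0
  η_φ : ∀ (x : N) (v : TangentSpace 𝓘(ℝ, E) x), η x (φ x v) = 0
  compatible : ∀ (x : N) (v w : TangentSpace 𝓘(ℝ, E) x),
    inner ℝ (φ x v) (φ x w) = inner ℝ v w - η x v * η x w

variable {E N}

/-- `D` is the Levi-Civita connection of the Riemannian manifold `N`: it is torsion-free and
compatible with the metric, `v ⟨Y, Z⟩ = ⟨∇_v Y, Z⟩ + ⟨Y, ∇_v Z⟩`. -/
def IsLeviCivita (D : CovariantDerivative 𝓘(ℝ, E) E (fun x : N ↦ TangentSpace 𝓘(ℝ, E) x)) :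
    Prop :=
  D.torsion = 0 ∧
  ∀ (Y Z : Π x : N, TangentSpace 𝓘(ℝ, E) x) (x : N),
    MDifferentiableAt 𝓘(ℝ, E) (𝓘(ℝ, E).prod 𝓘(ℝ, E))
      (fun y ↦ TotalSpace.mk' E (E := fun x : N ↦ TangentSpace 𝓘(ℝ, E) x) y (Y y)) x →
    MDifferentiableAt 𝓘(ℝ, E) (𝓘(ℝ, E).prod 𝓘(ℝ, E))
      (fun y ↦ TotalSpace.mk' E (E := fun x : N ↦ TangentSpace 𝓘(ℝ, E) x) y (Z y)) x →
    ∀ v : TangentSpace 𝓘(ℝ, E) x,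
      mvfderiv 𝓘(ℝ, E) (fun y ↦ (inner ℝ (Y y) (Z y) : ℝ)) x v =
        inner ℝ (D Y x v) (Z x) + inner ℝ (Y x) (D Z x v)

/-- The Sasakian condition `(∇_v φ) Y = g(v, Y) ξ - η(Y) v`, where
`(∇_v φ) Y = ∇_v (φ Y) - φ (∇_v Y)` and `D = ∇` is meant to be the Levi-Civita connection.
Note that `D Y x v` is `∇_v Y` at `x`. -/
def AlmostContactMetricStructure.IsSasakian (S : AlmostContactMetricStructure E N)
    (D : CovariantDerivative 𝓘(ℝ, E) E (fun x : N ↦ TangentSpace 𝓘(ℝ, E) x)) : Prop :=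
  ∀ Y : Π x : N, TangentSpace 𝓘(ℝ, E) x,
    ContMDiff 𝓘(ℝ, E) (𝓘(ℝ, E).prod 𝓘(ℝ, E)) ∞
      (fun x ↦ TotalSpace.mk' E (E := fun x : N ↦ TangentSpace 𝓘(ℝ, E) x) x (Y x)) →
    ∀ (x : N) (v : TangentSpace 𝓘(ℝ, E) x),
      D (fun y ↦ S.φ y (Y y)) x v - S.φ x (D Y x v) =
        inner ℝ v (Y x) • S.ξ x - S.η x (Y x) • v

end Sasakian

/-! ### Submanifolds

A submanifold is given by a smooth map `j : M → N` (an immersion in the cases of interest). -/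

section Submanifold

variable {E : Type*} [NormedAddCommGroup E] [NormedSpace ℝ E] [FiniteDimensional ℝ E]
  {N : Type*} [TopologicalSpace N] [ChartedSpace E N] [IsManifold 𝓘(ℝ, E) ∞ N]
  [RiemannianBundle (fun x : N ↦ TangentSpace 𝓘(ℝ, E) x)]
  [IsContMDiffRiemannianBundle 𝓘(ℝ, E) ∞ E (fun x : N ↦ TangentSpace 𝓘(ℝ, E) x)]
  {F : Type*} [NormedAddCommGroup F] [NormedSpace ℝ F]
  {H : Type*} [TopologicalSpace H] (I : ModelWithCorners ℝ F H)
  {M : Type*} [TopologicalSpace M] [ChartedSpace H M]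

/-- The tangent space of the submanifold `j : M → N` at `p`, inside the tangent space of `N`. -/
noncomputable def imageTangent (j : M → N) (p : M) :
    Submodule ℝ (TangentSpace 𝓘(ℝ, E) (j p)) :=
  (mfderiv I 𝓘(ℝ, E) j p).range

/-- `t` is the angle between the vector `v` and the subspace `W`, i.e. the least angle between
`v` and a nonzero vector of `W`. -/
def IsAngleWithSubspace {V : Type*} [NormedAddCommGroup V] [InnerProductSpace ℝ V]
    (v : V) (W : Submodule ℝ V) (t : ℝ) : Prop :=
  IsLeast {s : ℝ | ∃ w ∈ W, w ≠ 0 ∧ s = InnerProductGeometry.angle v w} t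

/-- The submanifold `j : M → N` is invariant: `φ` maps its tangent spaces into themselves. -/
def IsInvariantSubmanifold (S : AlmostContactMetricStructure E N) (j : M → N) : Prop :=
  ∀ p : M, ∀ v ∈ imageTangent (E := E) I j p, S.φ (j p) v ∈ imageTangent (E := E) I j p

/-- The submanifold `j : M → N` is pointwise slant with slant function `θ`: for each `p` and each
nonzero tangent vector `v` of the submanifold at `p` that is not proportional to `ξ`, the angle
between `φ v` and the tangent space of the submanifold is `θ p`. -/
def IsPointwiseSlantSubmanifold (S : AlmostContactMetricStructure E N) (j : M → N)
    (θ : M → ℝ) : Prop :=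
  ∀ p : M, ∀ v ∈ imageTangent (E := E) I j p, v ≠ 0 → v ∉ Submodule.span ℝ {S.ξ (j p)} →
    IsAngleWithSubspace (S.φ (j p) v) (imageTangent (E := E) I j p) (θ p)

/-- The covariant derivative `∇_v s` at `p` of a vector field `s` along the map `j : M → N`.
In the trivialization of `TN` around `j p` it is the derivative of the coordinate vector of `s`
plus the covariant derivative of the vector field with constant coordinates that extends `s p`. -/
noncomputable def covDerivAlong
    (D : CovariantDerivative 𝓘(ℝ, E) E (fun x : N ↦ TangentSpace 𝓘(ℝ, E) x)) (j : M → N)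
    (s : Π q : M, TangentSpace 𝓘(ℝ, E) (j q)) (p : M) (v : TangentSpace I p) :
    TangentSpace 𝓘(ℝ, E) (j p) :=
  (trivializationAt E (fun x : N ↦ TangentSpace 𝓘(ℝ, E) x) (j p)).symm (j p)
      (mvfderiv I (fun q : M ↦
        (trivializationAt E (fun x : N ↦ TangentSpace 𝓘(ℝ, E) x) (j p)
          (TotalSpace.mk' E (j q) (s q))).2) p v) +
    D (FiberBundle.extend E (s p)) (j p) (mfderiv I 𝓘(ℝ, E) j p v)

/-- The second fundamental form of `j : M → N`: `h(X, Y)` is the component of `∇_X (dj Y)` normal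
to the submanifold. -/
noncomputable def secondFundamentalForm
    (D : CovariantDerivative 𝓘(ℝ, E) E (fun x : N ↦ TangentSpace 𝓘(ℝ, E) x)) (j : M → N)
    (X Y : Π q : M, TangentSpace I q) (p : M) : TangentSpace 𝓘(ℝ, E) (j p) :=
  haveI : FiniteDimensional ℝ (TangentSpace 𝓘(ℝ, E) (j p)) :=
    inferInstanceAs (FiniteDimensional ℝ E)
  (imageTangent (E := E) I j p)ᗮ.starProjection
    (covDerivAlong I D j (fun q ↦ mfderiv I 𝓘(ℝ, E) j q (Y q)) p (X p))

end Submanifold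

/-! ### Warped products -/

section WarpedProduct

variable {E₁ : Type*} [NormedAddCommGroup E₁] [NormedSpace ℝ E₁]
  {M₁ : Type*} [TopologicalSpace M₁] [ChartedSpace E₁ M₁] [IsManifold 𝓘(ℝ, E₁) ∞ M₁]
  [RiemannianBundle (fun x : M₁ ↦ TangentSpace 𝓘(ℝ, E₁) x)]
  {E₂ : Type*} [NormedAddCommGroup E₂] [NormedSpace ℝ E₂]
  {M₂ : Type*} [TopologicalSpace M₂] [ChartedSpace E₂ M₂] [IsManifold 𝓘(ℝ, E₂) ∞ M₂]
  [RiemannianBundle (fun x : M₂ ↦ TangentSpace 𝓘(ℝ, E₂) x)]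
  {E : Type*} [NormedAddCommGroup E] [NormedSpace ℝ E] [FiniteDimensional ℝ E]
  {N : Type*} [TopologicalSpace N] [ChartedSpace E N] [IsManifold 𝓘(ℝ, E) ∞ N]
  [RiemannianBundle (fun x : N ↦ TangentSpace 𝓘(ℝ, E) x)]
  [IsContMDiffRiemannianBundle 𝓘(ℝ, E) ∞ E (fun x : N ↦ TangentSpace 𝓘(ℝ, E) x)]

/-- The warped product metric `g = π₁^* g₁ + (f ∘ π₁)² π₂^* g₂` on `M₁ × M₂`. -/
noncomputable def warpedInner (f : M₁ → ℝ) (p : M₁ × M₂)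
    (u v : TangentSpace (𝓘(ℝ, E₁).prod 𝓘(ℝ, E₂)) p) : ℝ :=
  inner ℝ (mfderiv (𝓘(ℝ, E₁).prod 𝓘(ℝ, E₂)) 𝓘(ℝ, E₁) Prod.fst p u)
      (mfderiv (𝓘(ℝ, E₁).prod 𝓘(ℝ, E₂)) 𝓘(ℝ, E₁) Prod.fst p v) +
    f p.1 ^ 2 *
      inner ℝ (mfderiv (𝓘(ℝ, E₁).prod 𝓘(ℝ, E₂)) 𝓘(ℝ, E₂) Prod.snd p u)
        (mfderiv (𝓘(ℝ, E₁).prod 𝓘(ℝ, E₂)) 𝓘(ℝ, E₂) Prod.snd p v)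

/-- `j : M₁ × M₂ → N` is an isometric immersion of the warped product `M₁ ×_f M₂`, where
`f > 0` is a smooth function on `M₁`. (Injectivity of the differential follows.) -/
structure IsWarpedProductSubmanifold (f : M₁ → ℝ) (j : M₁ × M₂ → N) : Prop where
  smooth_f : ContMDiff 𝓘(ℝ, E₁) 𝓘(ℝ, ℝ) ∞ f
  f_pos : ∀ a, 0 < f a
  smooth_j : ContMDiff (𝓘(ℝ, E₁).prod 𝓘(ℝ, E₂)) 𝓘(ℝ, E) ∞ j
  isometric : ∀ (p : M₁ × M₂) (u v : TangentSpace (𝓘(ℝ, E₁).prod 𝓘(ℝ, E₂)) p),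
    inner ℝ (mfderiv (𝓘(ℝ, E₁).prod 𝓘(ℝ, E₂)) 𝓘(ℝ, E) j p u)
      (mfderiv (𝓘(ℝ, E₁).prod 𝓘(ℝ, E₂)) 𝓘(ℝ, E) j p v) = warpedInner f p u v

/-- `j : M₁ × M₂ → N` is a warped product pointwise semi-slant submanifold `M_T ×_f M_θ`, tangent
to the Reeb vector field, with `M_T = M₁`, `M_θ = M₂` and slant function `θ` on `M₁ × M₂`:
the copies `M₁ × {b}` of `M₁` are invariant and the copies `{a} × M₂` of `M₂` are pointwise slant
with slant function `θ (a, ·)`. -/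
structure IsWarpedProductPointwiseSemiSlant (S : AlmostContactMetricStructure E N)
    (f : M₁ → ℝ) (j : M₁ × M₂ → N) (θ : M₁ × M₂ → ℝ) : Prop where
  warped : IsWarpedProductSubmanifold (E₁ := E₁) (E₂ := E₂) (E := E) f j
  reeb_tangent : ∀ p, S.ξ (j p) ∈ imageTangent (E := E) (𝓘(ℝ, E₁).prod 𝓘(ℝ, E₂)) j p
  invariant : ∀ b : M₂, IsInvariantSubmanifold 𝓘(ℝ, E₁) S (fun a : M₁ ↦ j (a, b))
  slant : ∀ a : M₁,
    IsPointwiseSlantSubmanifold 𝓘(ℝ, E₂) S (fun b : M₂ ↦ j (a, b)) (fun b ↦ θ (a, b))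

/-- The slant function is that of a proper pointwise slant factor: it is neither identically `0`
nor identically `π / 2`, and it is not constant. -/
def IsProperSlantFunction {M : Type*} (θ : M → ℝ) : Prop :=
  ¬ (∀ p, θ p = 0) ∧ ¬ (∀ p, θ p = Real.pi / 2) ∧ ¬ ∃ c : ℝ, ∀ p, θ p = c

/-- `j : M₁ × M₂ → N` is mixed totally geodesic: `h(X, Z) = 0` for all vector fields `X` tangent
to the first factor and `Z` tangent to the second one (it is enough that they are smooth at the
point where `h(X, Z)` is taken). -/
def IsMixedTotallyGeodesic
    (D : CovariantDerivative 𝓘(ℝ, E) E (fun x : N ↦ TangentSpace 𝓘(ℝ, E) x))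
    (j : M₁ × M₂ → N) : Prop :=
  ∀ (p : M₁ × M₂) (X Z : Π q : M₁ × M₂, TangentSpace (𝓘(ℝ, E₁).prod 𝓘(ℝ, E₂)) q),
    ContMDiffAt (𝓘(ℝ, E₁).prod 𝓘(ℝ, E₂)) (𝓘(ℝ, E₁).prod 𝓘(ℝ, E₂)).tangent ∞
      (fun q ↦ TotalSpace.mk' (E₁ × E₂)
        (E := fun q : M₁ × M₂ ↦ TangentSpace (𝓘(ℝ, E₁).prod 𝓘(ℝ, E₂)) q) q (X q)) p →
    ContMDiffAt (𝓘(ℝ, E₁).prod 𝓘(ℝ, E₂)) (𝓘(ℝ, E₁).prod 𝓘(ℝ, E₂)).tangent ∞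
      (fun q ↦ TotalSpace.mk' (E₁ × E₂)
        (E := fun q : M₁ × M₂ ↦ TangentSpace (𝓘(ℝ, E₁).prod 𝓘(ℝ, E₂)) q) q (Z q)) p →
    (∀ q, mfderiv (𝓘(ℝ, E₁).prod 𝓘(ℝ, E₂)) 𝓘(ℝ, E₂) Prod.snd q (X q) = 0) →
    (∀ q, mfderiv (𝓘(ℝ, E₁).prod 𝓘(ℝ, E₂)) 𝓘(ℝ, E₁) Prod.fst q (Z q) = 0) →
    secondFundamentalForm (𝓘(ℝ, E₁).prod 𝓘(ℝ, E₂)) D j X Z p = 0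

end WarpedProduct

/-! The slant factor is forced to be anti-invariant, so θ is identically π/2, which properness
forbids. On a Sasakian manifold `∇_v ξ = -φ v`, hence `dη(X, Y) = -2 g(φ X, Y)`. A map along which η
pulls back to zero also pulls `dη` back to zero, so φ sends its tangent vectors to normal vectors
(`inner_φ_mfderiv_eq_zero`). Write `ξ = t + u` along the two factors. Invariance puts `φ² t = -t +
η(t) ξ` in the first factor; pairing with `u` gives `|t|² |u|² = 0`, so at each point ξ lies in one
factor (`reeb_orthogonal`). It cannot lie in the second. There `u ≠ 0`, an open condition, so ξ
would be orthogonal to a neighbourhood in an invariant slice. For `X` tangent to that slice, `φ X`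
would then be both tangent and normal to it, hence zero; with `η(X) = 0` this forces `X = 0`,
against positive dimension. So ξ is orthogonal to every slant slice, and the `dη` argument applied
to these slices gives θ = π/2. -/

set_option linter.unusedSectionVars false

/-! ### Closedness of a vanishing pullback, in vector spaces -/

/-- Pullbacks commute with exterior derivatives: if the pullback of the `1`-form `β` by `κ`
vanishes near `x`, where `β` is given along `κ`, then the derivative of `β` is symmetric on the
range of the differential of `κ`. -/
theorem fderiv_apply_fderiv_comm_of_eventually_apply_fderiv_eq_zero
    {E' : Type*} [NormedAddCommGroup E'] [NormedSpace ℝ E']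
    {E : Type*} [NormedAddCommGroup E] [NormedSpace ℝ E]
    {β : E' → E →L[ℝ] ℝ} {κ : E' → E} {x : E'} (hβ : DifferentiableAt ℝ β x)
    (hκ : ContDiffAt ℝ ∞ κ x) (h : ∀ᶠ y in 𝓝 x, ∀ w, β y (fderiv ℝ κ y w) = 0) (z w : E') :
    fderiv ℝ β x z (fderiv ℝ κ x w) = fderiv ℝ β x w (fderiv ℝ κ x z) := by
  have hd : DifferentiableAt ℝ (fderiv ℝ κ) x :=
    (hκ.fderiv_right (m := 1) (by norm_cast)).differentiableAt one_ne_zero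
  -- Product rule for `β y (κ' y w) = 0` in the direction `z`; the second-derivative term is
  -- symmetric in `z` and `w`, so it cancels between the two orders.
  have key : ∀ z w, fderiv ℝ β x z (fderiv ℝ κ x w) + β x (fderiv ℝ (fderiv ℝ κ) x z w) = 0 := by
    intro z w
    have h0 : (fun y ↦ β y (fderiv ℝ κ y w)) =ᶠ[𝓝 x] fun _ ↦ 0 := h.mono fun y hy ↦ hy w
    have h1 := hβ.hasFDerivAt.clm_apply (hd.hasFDerivAt.clm_apply (hasFDerivAt_const w x))
    have h2 := h1.fderiv.symm.trans h0.fderiv_eq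
    have h3 := congrArg (fun L : E' →L[ℝ] ℝ ↦ L z) h2
    simp at h3
    linarith
  have hs : fderiv ℝ (fderiv ℝ κ) x z w = fderiv ℝ (fderiv ℝ κ) x w z :=
    (hκ.isSymmSndFDerivAt (by simp; norm_cast)) z w
  have h1 := key z w
  have h2 := key w z
  rw [hs] at h1
  linarith

/-! ### Tensor identities and `dη` on a Sasakian manifold -/

section Sasakian

variable {E : Type*} [NormedAddCommGroup E] [NormedSpace ℝ E] [FiniteDimensional ℝ E]
  {N : Type*} [TopologicalSpace N] [ChartedSpace E N] [IsManifold 𝓘(ℝ, E) ∞ N]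
  [RiemannianBundle (fun x : N ↦ TangentSpace 𝓘(ℝ, E) x)]
  [IsContMDiffRiemannianBundle 𝓘(ℝ, E) ∞ E (fun x : N ↦ TangentSpace 𝓘(ℝ, E) x)]

namespace AlmostContactMetricStructure

variable (S : AlmostContactMetricStructure E N)

theorem inner_ξ (x : N) (v : TangentSpace 𝓘(ℝ, E) x) : inner ℝ v (S.ξ x) = S.η x v := by
  have h := S.compatible x v (S.ξ x)
  rw [S.φ_ξ, inner_zero_right, S.η_ξ] at h
  linarith

theorem inner_ξ_left (x : N) (v : TangentSpace 𝓘(ℝ, E) x) : inner ℝ (S.ξ x) v = S.η x v := by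
  rw [real_inner_comm, S.inner_ξ]

/-- Compatibility for the pair `v`, `φ w`, where `φ²` produces `-w` and a multiple of ξ that is
orthogonal to `φ v`. -/
theorem inner_φ_left (x : N) (v w : TangentSpace 𝓘(ℝ, E) x) :
    inner ℝ (S.φ x v) w = -inner ℝ v (S.φ x w) := by
  have h := S.compatible x v (S.φ x w)
  rw [S.φ_φ, S.η_φ, inner_add_right, inner_neg_right, inner_smul_right, S.inner_ξ, S.η_φ] at h
  linarith

theorem eq_zero_of_φ_eq_zero {x : N} {v : TangentSpace 𝓘(ℝ, E) x} (hφ : S.φ x v = 0)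
    (hη : S.η x v = 0) : v = 0 := by
  have h := S.φ_φ x v
  rw [hφ, map_zero, hη, zero_smul, add_zero] at h
  exact neg_eq_zero.mp h.symm

variable {S}
variable {D : CovariantDerivative 𝓘(ℝ, E) E (fun x : N ↦ TangentSpace 𝓘(ℝ, E) x)}

theorem mdifferentiableAt_ξ (x : N) : MDifferentiableAt 𝓘(ℝ, E) (𝓘(ℝ, E).prod 𝓘(ℝ, E))
      (fun y ↦ TotalSpace.mk' E (E := fun x : N ↦ TangentSpace 𝓘(ℝ, E) x) y (S.ξ y)) x :=
  S.smooth_ξ.mdifferentiable (by simp) x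

/-- On a Sasakian manifold `∇_v ξ = -φ v`. -/
theorem IsSasakian.covariantDerivative_ξ (hD : IsLeviCivita D) (hS : S.IsSasakian D) (x : N)
    (v : TangentSpace 𝓘(ℝ, E) x) : D S.ξ x v = -S.φ x v := by
  have h := hS S.ξ S.smooth_ξ x v
  have h0 : (fun y ↦ S.φ y (S.ξ y)) = 0 := funext fun y ↦ S.φ_ξ y
  -- Since ξ has constant length, `η(∇_v ξ) = 0`; hence applying φ below to `φ(∇_v ξ)` recovers
  -- `-∇_v ξ` with no ξ component.
  have h1 : inner ℝ (D S.ξ x v) (S.ξ x) = 0 := by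
    have hm := hD.2 S.ξ S.ξ x (S.mdifferentiableAt_ξ x) (S.mdifferentiableAt_ξ x) v
    have hc : (fun y ↦ (inner ℝ (S.ξ y) (S.ξ y) : ℝ)) = fun _ ↦ 1 :=
      funext fun y ↦ by rw [S.inner_ξ, S.η_ξ]
    rw [hc, mvfderiv_const, real_inner_comm (D S.ξ x v)] at hm
    simp at hm
    linarith
  rw [S.inner_ξ] at h1
  rw [h0, D.zero, S.inner_ξ, S.η_ξ, one_smul] at h
  have h2 := congrArg (S.φ x) h
  simp only [Pi.zero_apply, zero_apply, zero_sub, map_neg, map_sub, map_smul,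
    S.φ_ξ, smul_zero, S.φ_φ, h1, zero_smul, add_zero, neg_neg] at h2
  exact h2

/-- On a Sasakian manifold `dη(X, Y) = -2 g(φ X, Y)`, stated for commuting vector fields. -/
theorem IsSasakian.mvfderiv_inner_ξ_sub (hD : IsLeviCivita D) (hS : S.IsSasakian D) {x : N}
    {X Y : Π y : N, TangentSpace 𝓘(ℝ, E) y}
    (hX : MDifferentiableAt 𝓘(ℝ, E) (𝓘(ℝ, E).prod 𝓘(ℝ, E))
      (fun y ↦ TotalSpace.mk' E (E := fun x : N ↦ TangentSpace 𝓘(ℝ, E) x) y (X y)) x)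
    (hY : MDifferentiableAt 𝓘(ℝ, E) (𝓘(ℝ, E).prod 𝓘(ℝ, E))
      (fun y ↦ TotalSpace.mk' E (E := fun x : N ↦ TangentSpace 𝓘(ℝ, E) x) y (Y y)) x)
    (hXY : VectorField.mlieBracket 𝓘(ℝ, E) X Y x = 0) :
    mvfderiv 𝓘(ℝ, E) (fun y ↦ (inner ℝ (S.ξ y) (Y y) : ℝ)) x (X x) -
      mvfderiv 𝓘(ℝ, E) (fun y ↦ (inner ℝ (S.ξ y) (X y) : ℝ)) x (Y x) =
      -2 * inner ℝ (S.φ x (X x)) (Y x) := by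
  -- Zero torsion and zero bracket give `∇_X Y = ∇_Y X`, so only the derivatives of ξ survive.
  have ht := D.torsion_eq_zero_iff.mp hD.1 hX hY
  rw [hXY, sub_eq_zero] at ht
  rw [hD.2 _ _ x (S.mdifferentiableAt_ξ x) hY, hD.2 _ _ x (S.mdifferentiableAt_ξ x) hX, ht,
    hS.covariantDerivative_ξ hD, hS.covariantDerivative_ξ hD, inner_neg_left, inner_neg_left,
    S.inner_φ_left x (Y x), real_inner_comm (S.φ x (X x)) (Y x)]
  ring

end AlmostContactMetricStructure
end Sasakian

/-! ### Commuting coordinate vector fields -/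

section ConstantFields

variable {E : Type*} [NormedAddCommGroup E] [NormedSpace ℝ E]

/-- A constant vector field on a vector space. -/
def constField (v : E) (y : E) : TangentSpace 𝓘(ℝ, E) y := v

theorem mdifferentiableAt_constField (v x : E) :
    MDifferentiableAt 𝓘(ℝ, E) (𝓘(ℝ, E).prod 𝓘(ℝ, E))
      (fun y ↦ TotalSpace.mk' E (E := fun x : E ↦ TangentSpace 𝓘(ℝ, E) x) y (constField v y)) x :=
  (contMDiffAt_vectorSpace_iff_contDiffAt (n := 1).mpr
    (contDiffAt_const (c := v))).mdifferentiableAt one_ne_zero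

theorem mlieBracket_constField (u v x : E) :
    VectorField.mlieBracket 𝓘(ℝ, E) (constField u) (constField v) x = 0 := by
  have h : VectorField.lieBracketWithin ℝ (fun _ : E ↦ u) (fun _ ↦ v) Set.univ x = 0 := by
    simp [VectorField.lieBracketWithin]
  exact (congrFun (VectorField.mlieBracketWithin_eq_lieBracketWithin
    (V := constField u) (W := constField v) (s := Set.univ)) x).trans h

variable [FiniteDimensional ℝ E]
  {N : Type*} [TopologicalSpace N] [ChartedSpace E N] [IsManifold 𝓘(ℝ, E) ∞ N]

/-- The vector field with constant coordinates `v` in the chart at `x₀`. -/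
noncomputable def chartConstField (x₀ : N) (v : E) : Π y : N, TangentSpace 𝓘(ℝ, E) y :=
  VectorField.mpullback 𝓘(ℝ, E) 𝓘(ℝ, E) (extChartAt 𝓘(ℝ, E) x₀) (constField v)

theorem chartConstField_mfderiv {x₀ y : N} (hy : y ∈ (extChartAt 𝓘(ℝ, E) x₀).source)
    (u : TangentSpace 𝓘(ℝ, E) y) :
    chartConstField x₀
      (show E from mfderiv 𝓘(ℝ, E) 𝓘(ℝ, E) (extChartAt 𝓘(ℝ, E) x₀) y u) y = u :=
  (isInvertible_mfderiv_extChartAt hy).inverse_apply_eq.mpr rfl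

theorem mdifferentiableAt_chartConstField (x₀ : N) (v : E) :
    MDifferentiableAt 𝓘(ℝ, E) (𝓘(ℝ, E).prod 𝓘(ℝ, E))
      (fun y ↦ TotalSpace.mk' E (E := fun x : N ↦ TangentSpace 𝓘(ℝ, E) x) y
        (chartConstField x₀ v y)) x₀ :=
  have : IsManifold 𝓘(ℝ, E) 2 N := IsManifold.of_le (n := ∞) (by norm_cast)
  MDifferentiableAt.mpullback_vectorField (n := ∞) (mdifferentiableAt_constField v _)
    contMDiffAt_extChartAt (isInvertible_mfderiv_extChartAt (mem_extChartAt_source x₀))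
    (by norm_cast)

/-- Pullback by the chart respects brackets, and constant fields on the model space commute. -/
theorem mlieBracket_chartConstField (x₀ : N) (u v : E) :
    VectorField.mlieBracket 𝓘(ℝ, E) (chartConstField x₀ u) (chartConstField x₀ v) x₀ = 0 := by
  have : IsManifold 𝓘(ℝ, E) (minSmoothness ℝ 2) N :=
    IsManifold.of_le (n := ∞) (by simp; norm_cast)
  have : IsManifold 𝓘(ℝ, E) (minSmoothness ℝ 2) E :=
    IsManifold.of_le (n := ∞) (by simp; norm_cast)
  refine (VectorField.mpullback_mlieBracket (I := 𝓘(ℝ, E)) (I' := 𝓘(ℝ, E)) (n := ∞)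
    (mdifferentiableAt_constField u _) (mdifferentiableAt_constField v _)
    contMDiffAt_extChartAt (by simp; norm_cast)).symm.trans ?_
  rw [VectorField.mpullback_apply, mlieBracket_constField, map_zero]

end ConstantFields

/-- In finite dimension a linear map is the tuple of its values on a basis. -/
theorem differentiableAt_clm_of_forall_apply {F : Type*} [NormedAddCommGroup F] [NormedSpace ℝ F]
    {E : Type*} [NormedAddCommGroup E] [NormedSpace ℝ E] [FiniteDimensional ℝ E]
    {G : Type*} [NormedAddCommGroup G] [NormedSpace ℝ G] {β : F → E →L[ℝ] G} {p : F}
    (h : ∀ v, DifferentiableAt ℝ (fun q ↦ β q v) p) : DifferentiableAt ℝ β p := by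
  let e₁ : E ≃L[ℝ] (Fin (Module.finrank ℝ E) → ℝ) :=
    ContinuousLinearEquiv.ofFinrankEq (Module.finrank_fin_fun ℝ).symm
  let e₂ := (e₁.arrowCongr (1 : G ≃L[ℝ] G)).trans
    (ContinuousLinearEquiv.piRing (Fin (Module.finrank ℝ E)))
  rw [← Function.id_comp β, ← e₂.symm_comp_self]
  exact e₂.symm.differentiableAt.comp p (differentiableAt_pi.mpr fun i ↦ h _)

/-! ### Maps orthogonal to the Reeb field -/

section Sasakian

variable {E : Type*} [NormedAddCommGroup E] [NormedSpace ℝ E] [FiniteDimensional ℝ E]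
  {N : Type*} [TopologicalSpace N] [ChartedSpace E N] [IsManifold 𝓘(ℝ, E) ∞ N]
  [RiemannianBundle (fun x : N ↦ TangentSpace 𝓘(ℝ, E) x)]
  [IsContMDiffRiemannianBundle 𝓘(ℝ, E) ∞ E (fun x : N ↦ TangentSpace 𝓘(ℝ, E) x)]
  {F : Type*} [NormedAddCommGroup F] [NormedSpace ℝ F]
  {M : Type*} [TopologicalSpace M] [ChartedSpace F M] [IsManifold 𝓘(ℝ, F) ∞ M]

/-- If a map `r` from a vector space into a Sasakian manifold is orthogonal to the Reeb field, then
`φ` maps its tangent vectors to vectors orthogonal to it. -/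
theorem AlmostContactMetricStructure.IsSasakian.inner_φ_mfderiv_eq_zero_of_vectorSpace
    {S : AlmostContactMetricStructure E N}
    {D : CovariantDerivative 𝓘(ℝ, E) E (fun x : N ↦ TangentSpace 𝓘(ℝ, E) x)}
    (hD : IsLeviCivita D) (hS : S.IsSasakian D) {r : F → N} {p : F}
    (hr : ContMDiffAt 𝓘(ℝ, F) 𝓘(ℝ, E) ∞ r p)
    (h : ∀ᶠ q in 𝓝 p, ∀ w : TangentSpace 𝓘(ℝ, F) q,
      inner ℝ (S.ξ (r q)) (mfderiv 𝓘(ℝ, F) 𝓘(ℝ, E) r q w) = 0) (z w : TangentSpace 𝓘(ℝ, F) p) :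
    inner ℝ (S.φ (r p) (mfderiv 𝓘(ℝ, F) 𝓘(ℝ, E) r p z)) (mfderiv 𝓘(ℝ, F) 𝓘(ℝ, E) r p w) = 0 := by
  set ψ := extChartAt 𝓘(ℝ, E) (r p) with hψ
  let κ : F → E := fun q ↦ ψ (r q)
  let f : E → N → ℝ := fun v y ↦ inner ℝ (S.ξ y) (chartConstField (r p) v y)
  -- The form η along `r`, written in the fixed chart at `r p`.
  let β : F → E →L[ℝ] ℝ := fun q ↦
    (innerSL ℝ (S.ξ (r q))).comp (mfderiv 𝓘(ℝ, E) 𝓘(ℝ, E) ψ (r q)).inverse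
  have hβf : ∀ v q, β q v = f v (r q) := fun v q ↦ rfl
  have hf : ∀ v, MDifferentiableAt 𝓘(ℝ, E) 𝓘(ℝ, ℝ) (f v) (r p) := fun v ↦
    MDifferentiableAt.inner_bundle (F := E) (E := fun x : N ↦ TangentSpace 𝓘(ℝ, E) x)
      (S.mdifferentiableAt_ξ _) (mdifferentiableAt_chartConstField _ v)
  have hr1 : MDifferentiableAt 𝓘(ℝ, F) 𝓘(ℝ, E) r p := hr.mdifferentiableAt (by simp)
  have hκ : ContDiffAt ℝ ∞ κ p :=
    (contMDiffAt_extChartAt.comp p hr).contDiffAt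
  let G : E → F →L[ℝ] ℝ := fun v ↦
    (mvfderiv 𝓘(ℝ, E) (f v) (r p)).comp (mfderiv 𝓘(ℝ, F) 𝓘(ℝ, E) r p)
  have hfr : ∀ v, HasFDerivAt (fun q ↦ β q v) (G v) p := fun v ↦
    ((hf v).hasMFDerivAt.comp p hr1.hasMFDerivAt).hasFDerivAt
  have hβ : DifferentiableAt ℝ β p :=
    differentiableAt_clm_of_forall_apply fun v ↦ (hfr v).differentiableAt
  have hβd : ∀ z v, fderiv ℝ β p z v = G v z := by
    intro z v
    have h1 := hβ.hasFDerivAt.clm_apply (hasFDerivAt_const v p)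
    have h2 := congrArg (fun L : F →L[ℝ] ℝ ↦ L z) (h1.unique (hfr v))
    simpa using h2
  have hmem : ∀ᶠ q in 𝓝 p, r q ∈ ψ.source :=
    hr.continuousAt.eventually (extChartAt_source_mem_nhds (r p))
  have hdiff : ∀ᶠ q in 𝓝 p, MDifferentiableAt 𝓘(ℝ, F) 𝓘(ℝ, E) r q := by
    have := ((contMDiffAt_iff_contMDiffAt_nhds (n := 1) (by simp)).mp (hr.of_le (by norm_cast)))
    exact this.mono fun q hq ↦ hq.mdifferentiableAt one_ne_zero
  have hκd : ∀ q, r q ∈ ψ.source → MDifferentiableAt 𝓘(ℝ, F) 𝓘(ℝ, E) r q → ∀ w,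
      fderiv ℝ κ q w = mfderiv 𝓘(ℝ, E) 𝓘(ℝ, E) ψ (r q) (mfderiv 𝓘(ℝ, F) 𝓘(ℝ, E) r q w) := by
    intro q hq hrq w
    let L : F →L[ℝ] E := (mfderiv 𝓘(ℝ, E) 𝓘(ℝ, E) ψ (r q)).comp (mfderiv 𝓘(ℝ, F) 𝓘(ℝ, E) r q)
    have h1 : HasMFDerivAt 𝓘(ℝ, F) 𝓘(ℝ, E) κ q L :=
      (mdifferentiableAt_extChartAt
        (by rwa [hψ, extChartAt_source] at hq)).hasMFDerivAt.comp q hrq.hasMFDerivAt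
    have h2 : HasFDerivAt κ L q := h1.hasFDerivAt
    exact congrArg (fun L : F →L[ℝ] E ↦ L w) h2.fderiv
  have hV : ∀ q, r q ∈ ψ.source → MDifferentiableAt 𝓘(ℝ, F) 𝓘(ℝ, E) r q → ∀ w,
      chartConstField (r p) (fderiv ℝ κ q w) (r q) = mfderiv 𝓘(ℝ, F) 𝓘(ℝ, E) r q w := by
    intro q hq hrq w
    rw [hκd q hq hrq w]
    exact chartConstField_mfderiv hq _
  have hzero : ∀ᶠ q in 𝓝 p, ∀ w, β q (fderiv ℝ κ q w) = 0 := by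
    filter_upwards [hmem, hdiff, h] with q hq hrq hq0 w
    rw [hβf]
    change inner ℝ (S.ξ (r q)) (chartConstField (r p) (fderiv ℝ κ q w) (r q)) = 0
    rw [hV q hq hrq w]
    exact hq0 w
  -- The two derivatives whose difference is the `dη` term of `hbr` agree, because the pullback of η
  -- vanishes near `p`.
  have hsymm := (hβd z _).symm.trans
    ((fderiv_apply_fderiv_comm_of_eventually_apply_fderiv_eq_zero hβ hκ hzero z w).trans (hβd w _))
  have hbr := hS.mvfderiv_inner_ξ_sub hD (mdifferentiableAt_chartConstField (r p) (fderiv ℝ κ p z))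
    (mdifferentiableAt_chartConstField (r p) (fderiv ℝ κ p w))
    (mlieBracket_chartConstField _ _ _)
  have hp := hmem.self_of_nhds
  rw [hV p hp hr1 z, hV p hp hr1 w] at hbr
  change mvfderiv 𝓘(ℝ, E) (f _) _ _ - mvfderiv 𝓘(ℝ, E) (f _) _ _ = _ at hbr
  have h0 := (sub_eq_zero.mpr hsymm).symm.trans hbr
  linarith

/-- A map into a Sasakian manifold that is orthogonal to the Reeb field near `p` is anti-invariant
at `p`: `φ` maps its tangent vectors to normal vectors. -/
theorem AlmostContactMetricStructure.IsSasakian.inner_φ_mfderiv_eq_zero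
    {S : AlmostContactMetricStructure E N}
    {D : CovariantDerivative 𝓘(ℝ, E) E (fun x : N ↦ TangentSpace 𝓘(ℝ, E) x)}
    (hD : IsLeviCivita D) (hS : S.IsSasakian D) {k : M → N}
    (hk : ContMDiff 𝓘(ℝ, F) 𝓘(ℝ, E) ∞ k) {p : M}
    (h : ∀ᶠ q in 𝓝 p, ∀ w : TangentSpace 𝓘(ℝ, F) q,
      inner ℝ (S.ξ (k q)) (mfderiv 𝓘(ℝ, F) 𝓘(ℝ, E) k q w) = 0) (z w : TangentSpace 𝓘(ℝ, F) p) :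
    inner ℝ (S.φ (k p) (mfderiv 𝓘(ℝ, F) 𝓘(ℝ, E) k p z)) (mfderiv 𝓘(ℝ, F) 𝓘(ℝ, E) k p w) = 0 := by
  set e := extChartAt 𝓘(ℝ, F) p with he
  have hsp : e.symm (e p) = p := extChartAt_to_inv p
  have htgt : e.target ∈ 𝓝 (e p) := extChartAt_target_mem_nhds p
  have hs : ∀ x ∈ e.target, ContMDiffAt 𝓘(ℝ, F) 𝓘(ℝ, F) ∞ e.symm x := fun x hx ↦
    (contMDiffOn_extChartAt_symm p).contMDiffAt ((isOpen_extChartAt_target p).mem_nhds hx)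
  have hd : ∀ x ∈ e.target, ∀ u : TangentSpace 𝓘(ℝ, F) x,
      mfderiv 𝓘(ℝ, F) 𝓘(ℝ, E) (k ∘ e.symm) x u =
        mfderiv 𝓘(ℝ, F) 𝓘(ℝ, E) k (e.symm x) (mfderiv 𝓘(ℝ, F) 𝓘(ℝ, F) e.symm x u) :=
    fun x hx u ↦ mfderiv_comp_apply x (hk.mdifferentiable (by simp) _)
      ((hs x hx).mdifferentiableAt (by simp)) u
  have hsurj : ∀ z : TangentSpace 𝓘(ℝ, F) (e.symm (e p)), ∃ u : TangentSpace 𝓘(ℝ, F) (e p),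
      mfderiv 𝓘(ℝ, F) 𝓘(ℝ, F) e.symm (e p) u = z := by
    have := isInvertible_mfderivWithin_extChartAt_symm (I := 𝓘(ℝ, F)) (mem_extChartAt_target p)
    rw [ModelWithCorners.range_eq_univ, mfderivWithin_univ] at this
    exact this.bijective.surjective
  -- Stated at `e.symm (e p)`, where the chain rule puts the tangent vectors; `hsp` then moves it to
  -- `p`.
  have key : ∀ z w : TangentSpace 𝓘(ℝ, F) (e.symm (e p)),
      inner ℝ (S.φ _ (mfderiv 𝓘(ℝ, F) 𝓘(ℝ, E) k (e.symm (e p)) z))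
        (mfderiv 𝓘(ℝ, F) 𝓘(ℝ, E) k (e.symm (e p)) w) = 0 := by
    intro z w
    obtain ⟨u, rfl⟩ := hsurj z
    obtain ⟨v, rfl⟩ := hsurj w
    have := hS.inner_φ_mfderiv_eq_zero_of_vectorSpace hD (r := k ∘ e.symm) (p := e p)
      (hk.contMDiffAt.comp _ (hs _ (mem_extChartAt_target p))) ?_ u v
    · rwa [hd _ (mem_extChartAt_target p), hd _ (mem_extChartAt_target p)] at this
    · have hc : Filter.Tendsto e.symm (𝓝 (e p)) (𝓝 p) := by
        have := (hs _ (mem_extChartAt_target p)).continuousAt.tendsto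
        rwa [hsp] at this
      filter_upwards [hc.eventually h, htgt] with x hx hxt w
      rw [hd x hxt]
      exact hx _
  rw [hsp] at key
  exact key z w

end Sasakian

/-- The least angle is attained at some vector of `W`, which is orthogonal to `v`. -/
theorem IsAngleWithSubspace.eq_pi_div_two {V : Type*} [NormedAddCommGroup V]
    [InnerProductSpace ℝ V] {v : V} {W : Submodule ℝ V} {t : ℝ} (ht : IsAngleWithSubspace v W t)
    (h : ∀ w ∈ W, inner ℝ v w = 0) : t = Real.pi / 2 := by
  obtain ⟨w, hw, -, rfl⟩ := ht.1
  exact InnerProductGeometry.inner_eq_zero_iff_angle_eq_pi_div_two _ _ |>.mp (h w hw)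

/-! ### Splitting the differential along the two factors -/

section WarpedProduct

variable {E₁ : Type*} [NormedAddCommGroup E₁] [NormedSpace ℝ E₁]
  {M₁ : Type*} [TopologicalSpace M₁] [ChartedSpace E₁ M₁] [IsManifold 𝓘(ℝ, E₁) ∞ M₁]
  {E₂ : Type*} [NormedAddCommGroup E₂] [NormedSpace ℝ E₂]
  {M₂ : Type*} [TopologicalSpace M₂] [ChartedSpace E₂ M₂] [IsManifold 𝓘(ℝ, E₂) ∞ M₂]
  {E : Type*} [NormedAddCommGroup E] [NormedSpace ℝ E] [FiniteDimensional ℝ E]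
  {N : Type*} [TopologicalSpace N] [ChartedSpace E N] [IsManifold 𝓘(ℝ, E) ∞ N]

/-- The differential of `j` on vectors tangent to the first factor. -/
noncomputable def mfderivLeft (j : M₁ × M₂ → N) (a : M₁) (b : M₂) :
    TangentSpace 𝓘(ℝ, E₁) a →L[ℝ] TangentSpace 𝓘(ℝ, E) (j (a, b)) :=
  mfderiv 𝓘(ℝ, E₁) 𝓘(ℝ, E) (fun a ↦ j (a, b)) a

/-- The differential of `j` on vectors tangent to the second factor. -/
noncomputable def mfderivRight (j : M₁ × M₂ → N) (a : M₁) (b : M₂) :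
    TangentSpace 𝓘(ℝ, E₂) b →L[ℝ] TangentSpace 𝓘(ℝ, E) (j (a, b)) :=
  mfderiv 𝓘(ℝ, E₂) 𝓘(ℝ, E) (fun b ↦ j (a, b)) b

/-- The tangent vector of a product with components `x` and `z`. -/
def tangentPair {a : M₁} {b : M₂} (x : TangentSpace 𝓘(ℝ, E₁) a) (z : TangentSpace 𝓘(ℝ, E₂) b) :
    TangentSpace (𝓘(ℝ, E₁).prod 𝓘(ℝ, E₂)) (a, b) :=
  ((x, z) : E₁ × E₂)

variable {j : M₁ × M₂ → N} {a : M₁} {b : M₂}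

section

variable (hj : ContMDiff (𝓘(ℝ, E₁).prod 𝓘(ℝ, E₂)) 𝓘(ℝ, E) ∞ j)
include hj

theorem mfderivLeft_apply (x : TangentSpace 𝓘(ℝ, E₁) a) :
    mfderivLeft (E₁ := E₁) (E := E) j a b x =
      mfderiv (𝓘(ℝ, E₁).prod 𝓘(ℝ, E₂)) 𝓘(ℝ, E) j (a, b) (tangentPair x 0) := by
  have h := mfderiv_comp (I := 𝓘(ℝ, E₁)) (I' := 𝓘(ℝ, E₁).prod 𝓘(ℝ, E₂)) (I'' := 𝓘(ℝ, E)) a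
    (g := j) (f := fun a : M₁ ↦ (a, b)) (hj.mdifferentiable (by simp) _)
    (mdifferentiableAt_id.prodMk mdifferentiableAt_const)
  rw [mfderiv_prod_left] at h
  exact congrArg (fun L : E₁ →L[ℝ] E ↦ L x) h

theorem mfderivRight_apply (z : TangentSpace 𝓘(ℝ, E₂) b) :
    mfderivRight (E₂ := E₂) (E := E) j a b z =
      mfderiv (𝓘(ℝ, E₁).prod 𝓘(ℝ, E₂)) 𝓘(ℝ, E) j (a, b) (tangentPair 0 z) := by
  have h := mfderiv_comp (I := 𝓘(ℝ, E₂)) (I' := 𝓘(ℝ, E₁).prod 𝓘(ℝ, E₂)) (I'' := 𝓘(ℝ, E)) b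
    (g := j) (f := fun b : M₂ ↦ (a, b)) (hj.mdifferentiable (by simp) _)
    (mdifferentiableAt_const.prodMk mdifferentiableAt_id)
  rw [mfderiv_prod_right] at h
  exact congrArg (fun L : E₂ →L[ℝ] E ↦ L z) h

theorem mfderiv_tangentPair (x : TangentSpace 𝓘(ℝ, E₁) a) (z : TangentSpace 𝓘(ℝ, E₂) b) :
    mfderiv (𝓘(ℝ, E₁).prod 𝓘(ℝ, E₂)) 𝓘(ℝ, E) j (a, b) (tangentPair x z) =
      mfderivLeft (E₁ := E₁) (E := E) j a b x + mfderivRight (E₂ := E₂) (E := E) j a b z := by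
  rw [mfderivLeft_apply hj, mfderivRight_apply hj, ← map_add]
  congr 1
  exact (Prod.fst_add_snd ((x, z) : E₁ × E₂)).symm

/-- Makes it an open condition on `a` that ξ has nonzero product with a fixed vector of the second
factor. -/
theorem continuous_mfderivRight (b : M₂) (z : TangentSpace 𝓘(ℝ, E₂) b) :
    Continuous (fun a : M₁ ↦ TotalSpace.mk' E (E := fun y : N ↦ TangentSpace 𝓘(ℝ, E) y)
      (j (a, b)) (mfderivRight (E₂ := E₂) (E := E) j a b z)) := by
  have h1 : Continuous (tangentMap (𝓘(ℝ, E₁).prod 𝓘(ℝ, E₂)) 𝓘(ℝ, E) j) :=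
    hj.continuous_tangentMap (by simp)
  have h2 : Continuous (equivTangentBundleProd 𝓘(ℝ, E₁) M₁ 𝓘(ℝ, E₂) M₂).symm :=
    (contMDiff_equivTangentBundleProd_symm (n := 0)).continuous
  have h3 : Continuous (zeroSection E₁ (fun a : M₁ ↦ TangentSpace 𝓘(ℝ, E₁) a)) :=
    (contMDiff_zeroSection ℝ _ (IB := 𝓘(ℝ, E₁)) (n := 0)).continuous
  have h4 := h1.comp (h2.comp
    (h3.prodMk (continuous_const (y := (⟨b, z⟩ : TangentBundle 𝓘(ℝ, E₂) M₂)))))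
  refine h4.congr fun a ↦ ?_
  rw [mfderivRight_apply hj]
  rfl

end

variable [RiemannianBundle (fun x : M₁ ↦ TangentSpace 𝓘(ℝ, E₁) x)]
  [RiemannianBundle (fun x : M₂ ↦ TangentSpace 𝓘(ℝ, E₂) x)]
  [RiemannianBundle (fun x : N ↦ TangentSpace 𝓘(ℝ, E) x)]
  [IsContMDiffRiemannianBundle 𝓘(ℝ, E) ∞ E (fun x : N ↦ TangentSpace 𝓘(ℝ, E) x)]
  {f : M₁ → ℝ}

theorem warpedInner_tangentPair (x x' : TangentSpace 𝓘(ℝ, E₁) a) (z z' : TangentSpace 𝓘(ℝ, E₂) b) :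
    warpedInner f (a, b) (tangentPair x z) (tangentPair x' z') =
      inner ℝ x x' + f a ^ 2 * inner ℝ z z' := by
  unfold warpedInner
  rw [mfderiv_fst, mfderiv_snd]
  rfl

namespace IsWarpedProductSubmanifold

variable (h : IsWarpedProductSubmanifold (E₁ := E₁) (E₂ := E₂) (E := E) f j)
include h

theorem inner_mfderiv (x x' : TangentSpace 𝓘(ℝ, E₁) a) (z z' : TangentSpace 𝓘(ℝ, E₂) b) :
    inner ℝ (mfderivLeft (E₁ := E₁) (E := E) j a b x + mfderivRight (E₂ := E₂) (E := E) j a b z)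
      (mfderivLeft (E₁ := E₁) (E := E) j a b x' + mfderivRight (E₂ := E₂) (E := E) j a b z') =
      inner ℝ x x' + f a ^ 2 * inner ℝ z z' := by
  rw [← mfderiv_tangentPair h.smooth_j, ← mfderiv_tangentPair h.smooth_j, h.isometric,
    warpedInner_tangentPair]

theorem inner_mfderivLeft_mfderivRight (x : TangentSpace 𝓘(ℝ, E₁) a) (z : TangentSpace 𝓘(ℝ, E₂) b) :
    inner ℝ (mfderivLeft (E₁ := E₁) (E := E) j a b x)
      (mfderivRight (E₂ := E₂) (E := E) j a b z) = 0 := by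
  simpa using h.inner_mfderiv x 0 0 z

theorem eq_zero_of_mfderivLeft_eq_zero {x : TangentSpace 𝓘(ℝ, E₁) a}
    (hx : mfderivLeft (E₁ := E₁) (E := E) j a b x = 0) : x = 0 := by
  simpa [hx, eq_comm] using h.inner_mfderiv (b := b) x x 0 0

theorem eq_zero_of_mfderivRight_eq_zero {z : TangentSpace 𝓘(ℝ, E₂) b}
    (hz : mfderivRight (E₂ := E₂) (E := E) j a b z = 0) : z = 0 := by
  simpa [hz, eq_comm, (h.f_pos a).ne'] using h.inner_mfderiv (a := a) 0 0 z z

end IsWarpedProductSubmanifold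

/-! ### Position of the Reeb field and the slant angle -/

namespace IsWarpedProductPointwiseSemiSlant

variable {S : AlmostContactMetricStructure E N} {θ : M₁ × M₂ → ℝ}
  (h : IsWarpedProductPointwiseSemiSlant (E₁ := E₁) (E₂ := E₂) S f j θ)
include h

theorem exists_φ_mfderivLeft (a : M₁) (b : M₂) (x : TangentSpace 𝓘(ℝ, E₁) a) :
    ∃ y, mfderivLeft (E₁ := E₁) (E := E) j a b y = S.φ (j (a, b)) (mfderivLeft (E₁ := E₁) (E := E) j a b x) :=
  h.invariant b a _ ⟨x, rfl⟩

theorem exists_ξ_eq (a : M₁) (b : M₂) : ∃ x z,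
    S.ξ (j (a, b)) = mfderivLeft (E₁ := E₁) (E := E) j a b x + mfderivRight (E₂ := E₂) (E := E) j a b z := by
  obtain ⟨u, hu⟩ := h.reeb_tangent (a, b)
  exact ⟨(show E₁ × E₂ from u).1, (show E₁ × E₂ from u).2,
    hu.symm.trans (mfderiv_tangentPair h.warped.smooth_j _ _)⟩

/-- At each point the Reeb field is orthogonal to one of the two factors. -/
theorem reeb_orthogonal (a : M₁) (b : M₂) :
    (∀ x, inner ℝ (S.ξ (j (a, b))) (mfderivLeft (E₁ := E₁) (E := E) j a b x) = 0) ∨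
      ∀ z, inner ℝ (S.ξ (j (a, b))) (mfderivRight (E₂ := E₂) (E := E) j a b z) = 0 := by
  obtain ⟨x, z, hξ⟩ := h.exists_ξ_eq a b
  obtain ⟨y, hy⟩ := h.exists_φ_mfderivLeft a b x
  -- φ is applied twice so that `φ² t`, which contains `η(t) ξ`, stays in the first factor.
  obtain ⟨y', hy'⟩ := h.exists_φ_mfderivLeft a b y
  set t := mfderivLeft (E₁ := E₁) (E := E) j a b x with ht
  set u := mfderivRight (E₂ := E₂) (E := E) j a b z with hu
  have htu : inner ℝ t u = 0 := h.warped.inner_mfderivLeft_mfderivRight x z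
  have hy'u : inner ℝ (mfderivLeft (E₁ := E₁) (E := E) j a b y') u = 0 :=
    h.warped.inner_mfderivLeft_mfderivRight y' z
  have hη : S.η _ t = inner ℝ t t := by
    rw [← S.inner_ξ, hξ, inner_add_right, htu, add_zero]
  have hmul : inner ℝ t t * inner ℝ u u = 0 := by
    rw [hy', hy, S.φ_φ, hξ, hη, inner_add_left, inner_neg_left, htu, inner_smul_left,
      inner_add_left, htu] at hy'u
    simpa using hy'u
  rcases mul_eq_zero.mp hmul with h0 | h0
  · left
    intro x'
    rw [hξ, inner_self_eq_zero.mp h0, zero_add, real_inner_comm]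
    exact h.warped.inner_mfderivLeft_mfderivRight x' z
  · right
    intro z'
    rw [hξ, inner_self_eq_zero.mp h0, add_zero]
    exact h.warped.inner_mfderivLeft_mfderivRight x z'

/-- Otherwise ξ, being tangent to the product, would be orthogonal to itself. -/
theorem exists_inner_ξ_mfderivRight_ne_zero
    (h0 : ∀ x, inner ℝ (S.ξ (j (a, b))) (mfderivLeft (E₁ := E₁) (E := E) j a b x) = 0) :
    ∃ z, inner ℝ (S.ξ (j (a, b))) (mfderivRight (E₂ := E₂) (E := E) j a b z) ≠ 0 := by
  by_contra! h1
  obtain ⟨x, z, hξ⟩ := h.exists_ξ_eq a b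
  have h2 := S.inner_ξ (j (a, b)) (S.ξ (j (a, b)))
  nth_rw 2 [hξ] at h2
  rw [S.η_ξ, inner_add_right, h0, h1] at h2
  norm_num at h2

variable {D : CovariantDerivative 𝓘(ℝ, E) E (fun x : N ↦ TangentSpace 𝓘(ℝ, E) x)}

/-- In a Sasakian manifold the Reeb field is nowhere orthogonal to the invariant factor. -/
theorem exists_inner_ξ_mfderivLeft_ne_zero [Nontrivial E₁] (hD : IsLeviCivita D)
    (hS : S.IsSasakian D) (a : M₁) (b : M₂) :
    ∃ x, inner ℝ (S.ξ (j (a, b))) (mfderivLeft (E₁ := E₁) (E := E) j a b x) ≠ 0 := by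
  by_contra! h0
  obtain ⟨z, hz⟩ := h.exists_inner_ξ_mfderivRight_ne_zero h0
  have hk : ContMDiff 𝓘(ℝ, E₁) 𝓘(ℝ, E) ∞ (fun a ↦ j (a, b)) :=
    h.warped.smooth_j.comp (contMDiff_id.prodMk contMDiff_const)
  have hξ : ContinuousAt (fun a : M₁ ↦ TotalSpace.mk' E
      (E := fun y : N ↦ TangentSpace 𝓘(ℝ, E) y) (j (a, b)) (S.ξ (j (a, b)))) a :=
    (S.smooth_ξ.continuous.comp hk.continuous).continuousAt
  have : IsContinuousRiemannianBundle E (fun y : N ↦ TangentSpace 𝓘(ℝ, E) y) := by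
    obtain ⟨g, hg, hgi⟩ := IsContMDiffRiemannianBundle.exists_contMDiff (IB := 𝓘(ℝ, E)) (n := ∞)
      (F := E) (E := fun y : N ↦ TangentSpace 𝓘(ℝ, E) y)
    exact ⟨⟨g, hg.continuous, hgi⟩⟩
  have hc : ContinuousAt
      (fun a ↦ (inner ℝ (S.ξ (j (a, b))) (mfderivRight (E₂ := E₂) (E := E) j a b z) : ℝ)) a :=
    ContinuousAt.inner_bundle (F := E) (E := fun y : N ↦ TangentSpace 𝓘(ℝ, E) y) hξ
      (continuous_mfderivRight h.warped.smooth_j b z).continuousAt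
  -- Near `a` the product with the fixed `z` stays nonzero, which rules out the second alternative
  -- of `reeb_orthogonal`.
  have hnear : ∀ᶠ a' in 𝓝 a, ∀ x,
      inner ℝ (S.ξ (j (a', b))) (mfderivLeft (E₁ := E₁) (E := E) j a' b x) = 0 :=
    (hc.eventually_ne hz).mono fun a' ha' ↦
      (h.reeb_orthogonal a' b).resolve_right fun h1 ↦ ha' (h1 _)
  obtain ⟨x, hx⟩ := exists_ne (0 : E₁)
  obtain ⟨y, hy⟩ := h.exists_φ_mfderivLeft a b x
  have hφ := hS.inner_φ_mfderiv_eq_zero hD hk hnear x y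
  change inner ℝ (S.φ (j (a, b)) (mfderivLeft (E₁ := E₁) (E := E) j a b x))
    (mfderivLeft (E₁ := E₁) (E := E) j a b y) = 0 at hφ
  -- With `y` chosen to represent `φ x`, `hφ` says that `φ x` has length zero.
  rw [hy] at hφ
  exact hx (h.warped.eq_zero_of_mfderivLeft_eq_zero (S.eq_zero_of_φ_eq_zero
    (inner_self_eq_zero.mp hφ) ((S.inner_ξ_left _ _).symm.trans (h0 x))))

/-- In a Sasakian manifold the slant factor is anti-invariant. -/
theorem slant_function_eq_pi_div_two [Nontrivial E₁] [Nontrivial E₂] (hD : IsLeviCivita D)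
    (hS : S.IsSasakian D) (a : M₁) (b : M₂) : θ (a, b) = Real.pi / 2 := by
  have hk : ContMDiff 𝓘(ℝ, E₂) 𝓘(ℝ, E) ∞ (fun b ↦ j (a, b)) :=
    h.warped.smooth_j.comp (contMDiff_const.prodMk contMDiff_id)
  have hnear : ∀ b' z, inner ℝ (S.ξ (j (a, b'))) (mfderivRight (E₂ := E₂) (E := E) j a b' z) = 0 :=
    fun b' ↦ (h.reeb_orthogonal a b').resolve_left fun h1 ↦
      (h.exists_inner_ξ_mfderivLeft_ne_zero hD hS a b').elim fun x hx ↦ hx (h1 x)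
  obtain ⟨z, hz⟩ := exists_ne (0 : E₂)
  have hv : mfderivRight (E₂ := E₂) (E := E) j a b z ≠ 0 := fun h0 ↦
    hz (h.warped.eq_zero_of_mfderivRight_eq_zero h0)
  refine (h.slant a b (mfderivRight (E₂ := E₂) (E := E) j a b z) ⟨z, rfl⟩ hv ?_).eq_pi_div_two ?_
  -- A multiple of ξ orthogonal to ξ is zero, so the slant condition does apply to this vector.
  · intro hmem
    obtain ⟨c, hc⟩ := Submodule.mem_span_singleton.mp hmem
    have h0 := hnear b z
    rw [← hc, inner_smul_right, S.inner_ξ_left, S.η_ξ, mul_one] at h0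
    rw [h0, zero_smul] at hc
    exact hv hc.symm
  · rintro _ ⟨w, rfl⟩
    exact hS.inner_φ_mfderiv_eq_zero hD hk (.of_forall hnear) z w

end IsWarpedProductPointwiseSemiSlant

end WarpedProduct

theorem corollary1
    {E : Type*} [NormedAddCommGroup E] [NormedSpace ℝ E] [FiniteDimensional ℝ E]
    {N : Type*} [TopologicalSpace N] [T2Space N] [ChartedSpace E N] [IsManifold 𝓘(ℝ, E) ∞ N]
    [RiemannianBundle (fun x : N ↦ TangentSpace 𝓘(ℝ, E) x)]
    [IsContMDiffRiemannianBundle 𝓘(ℝ, E) ∞ E (fun x : N ↦ TangentSpace 𝓘(ℝ, E) x)]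
    {E₁ : Type*} [NormedAddCommGroup E₁] [NormedSpace ℝ E₁] [FiniteDimensional ℝ E₁]
    [Nontrivial E₁]
    {M₁ : Type*} [TopologicalSpace M₁] [T2Space M₁] [ChartedSpace E₁ M₁]
    [IsManifold 𝓘(ℝ, E₁) ∞ M₁]
    [RiemannianBundle (fun x : M₁ ↦ TangentSpace 𝓘(ℝ, E₁) x)]
    [IsContMDiffRiemannianBundle 𝓘(ℝ, E₁) ∞ E₁ (fun x : M₁ ↦ TangentSpace 𝓘(ℝ, E₁) x)]
    {E₂ : Type*} [NormedAddCommGroup E₂] [NormedSpace ℝ E₂] [FiniteDimensional ℝ E₂]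
    [Nontrivial E₂]
    {M₂ : Type*} [TopologicalSpace M₂] [T2Space M₂] [ChartedSpace E₂ M₂]
    [IsManifold 𝓘(ℝ, E₂) ∞ M₂]
    [RiemannianBundle (fun x : M₂ ↦ TangentSpace 𝓘(ℝ, E₂) x)]
    [IsContMDiffRiemannianBundle 𝓘(ℝ, E₂) ∞ E₂ (fun x : M₂ ↦ TangentSpace 𝓘(ℝ, E₂) x)]
    (S : AlmostContactMetricStructure E N)
    (D : CovariantDerivative 𝓘(ℝ, E) E (fun x : N ↦ TangentSpace 𝓘(ℝ, E) x))
    (hD : IsLeviCivita D) (hS : S.IsSasakian D) :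
    ¬ ∃ (f : M₁ → ℝ) (j : M₁ × M₂ → N) (θ : M₁ × M₂ → ℝ),
      IsWarpedProductPointwiseSemiSlant (E₁ := E₁) (E₂ := E₂) S f j θ ∧
      IsProperSlantFunction θ ∧
      IsMixedTotallyGeodesic (E₁ := E₁) (E₂ := E₂) D j := by
  rintro ⟨f, j, θ, h, ⟨-, hθ, -⟩, -⟩
  exact hθ fun p ↦ h.slant_function_eq_pi_div_two hD hS p.1 p.2
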